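/- Let $n,m,\ell$ be positive integers with $\ell>2n$, let $N$ be an $n$-dimensional $C^\infty$ manifold without boundary (Hausdorff and second countable), let $U\subseteq\mathbb{R}^m$ be open, and let $F:U\to\mathbb{R}^\ell$ be a $C^\infty$ mapping. For a linear mapping $\pi:\mathbb{R}^m\to\mathbb{R}^\ell$ put $F_\pi=F+\pi|_U:U\to\mathbb{R}^\ell$, and identify the space $\mathcal{L}(\mathbb{R}^m,\mathbb{R}^\ell)$ of linear mappings $\mathbb{R}^m\to\mathbb{R}^\ell$ with $(\mathbb{R}^m)^\ell$ through matrix coefficients. Let $f:N\to U$ be an injective $C^\infty$ mapping. 1. There is a subset $\Sigma$ of $\mathcal{L}(\mathbb{R}^m,\mathbb{R}^\ell)$ with Lebesgue measure zero such that for every $\pi\in\mathcal{L}(\mathbb{R}^m,\mathbb{R}^\ell)\setminus\Sigma$ the mapping $F_\pi\circ f:N\to\mathbb{R}^\ell$ is injective. 2. If moreover $f$ is an immersion (its differential is injective at every point), then there is a subset $\Sigma$ of $\mathcal{L}(\mathbb{R}^m,\mathbb{R}^\ell)$ with Lebesgue measure zero such that for every $\pi\in\mathcal{L}(\mathbb{R}^m,\mathbb{R}^\ell)\setminus\Sigma$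 the mapping $F_\pi\circ f:N\to\mathbb{R}^\ell$ is an injective immersion. -/

import Mathlib

open scoped Manifold ContDiff

/-- The linear perturbation `F_π = F + π` of a map `F` by a linear map `π`. -/
def linearPerturbation {m l : ℕ}
    (F : EuclideanSpace ℝ (Fin m) → EuclideanSpace ℝ (Fin l))
    (π : EuclideanSpace ℝ (Fin m) →ₗ[ℝ] EuclideanSpace ℝ (Fin l)) :
    EuclideanSpace ℝ (Fin m) → EuclideanSpace ℝ (Fin l) :=
  fun x => F x + π x

/-- A set `S` of linear maps `ℝ^m → ℝ^l` has Lebesgue measure zero: under the natural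
identification of linear maps with their `l × m` matrices of coefficients (the bijection
`Matrix.toEuclideanLin`), `S` corresponds to a set of `l`-tuples of vectors of `ℝ^m`
whose Lebesgue measure is zero. -/
def HasLebesgueMeasureZero {m l : ℕ}
    (S : Set (EuclideanSpace ℝ (Fin m) →ₗ[ℝ] EuclideanSpace ℝ (Fin l))) : Prop :=
  MeasureTheory.volume
    {a : Fin l → Fin m → ℝ | Matrix.toEuclideanLin (Matrix.of a) ∈ S} = 0

/-- A map from an `n`-dimensional manifold to `ℝ^k` is a (smooth) immersion: it is `C^∞` and
its differential is injective at every point. -/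
def IsSmoothImmersion (n : ℕ) {k : ℕ} {N : Type*} [TopologicalSpace N]
    [ChartedSpace (EuclideanSpace ℝ (Fin n)) N]
    (g : N → EuclideanSpace ℝ (Fin k)) : Prop :=
  ContMDiff (𝓡 n) (𝓡 k) ∞ g ∧
    ∀ q : N, Function.Injective (mfderiv (𝓡 n) (𝓡 k) g q)

/-!
Both kinds of bad perturbation have the same shape. If `F_π ∘ f` identifies two points `p ≠ q`,
then `π d = c` with `d = f p - f q ≠ 0` and `c = F (f q) - F (f p)`; if its differential kills a
tangent vector `v` at `q`, then `π d = c` with `d = df_q v ≠ 0` and `c = -d(F ∘ f)_q v`. In a pair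
of charts, respectively in a chart of the tangent bundle, `d` and `c` are smooth functions of `2n`
real parameters, and `N` is covered by countably many charts.

So everything rests on `HasLebesgueMeasureZero.of_parametrized_equation`: if `d` and `c` are `C¹`
functions of fewer than `l` real parameters `x`, then the linear maps `π` satisfying `π (d x) = c x`
for some `x` with `d x ≠ 0` form a null set. Indeed, where the `j`-th coordinate of `d x` does not
vanish, the equation determines the `j`-th column of the matrix of `π` from `x` and the `l * (m - 1)`
other coefficients. The solutions are thus a `C¹` image of a set of Hausdorff dimension less than
`l + l * (m - 1) = l * m`, and such an image is Lebesgue null. This is where `2 * n < l` enters.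
-/

/-! ### Null sets of linear maps -/

open MeasureTheory Module

/-- A `C¹` image, in a space of strictly larger dimension, is null for every Haar measure. -/
theorem addHaar_image_eq_zero_of_finrank_lt {E G : Type*}
    [NormedAddCommGroup E] [NormedSpace ℝ E] [FiniteDimensional ℝ E]
    [NormedAddCommGroup G] [NormedSpace ℝ G] [FiniteDimensional ℝ G]
    [MeasurableSpace G] [BorelSpace G] (μ : Measure G) [μ.IsAddHaarMeasure]
    (h : finrank ℝ E < finrank ℝ G) {s : Set E} {Φ : E → G}
    (hΦ : ∀ x ∈ s, ContDiffAt ℝ 1 Φ x) : μ (Φ '' s) = 0 := by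
  have : ProperSpace E := FiniteDimensional.proper ℝ E
  have hdim : dimH (Φ '' s) < ((finrank ℝ G : NNReal) : ENNReal) := by
    calc dimH (Φ '' s) ≤ dimH s := by
          refine dimH_image_le_of_locally_lipschitzOn fun x hx => ?_
          obtain ⟨K, t, ht, hK⟩ := (hΦ x hx).exists_lipschitzOnWith
          exact ⟨K, t, mem_nhdsWithin_of_mem_nhds ht, hK⟩
      _ ≤ dimH (Set.univ : Set E) := dimH_mono (Set.subset_univ s)
      _ = finrank ℝ E := Real.dimH_univ_eq_finrank E
      _ < _ := by exact_mod_cast h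
  refine measure_zero_of_dimH_lt ?_ hdim
  rw [NNReal.coe_natCast]
  exact Measure.absolutelyContinuous_isAddHaarMeasure _ _

namespace HasLebesgueMeasureZero

variable {m l : ℕ}

theorem mono {S T : Set (EuclideanSpace ℝ (Fin m) →ₗ[ℝ] EuclideanSpace ℝ (Fin l))}
    (hT : HasLebesgueMeasureZero T) (h : S ⊆ T) : HasLebesgueMeasureZero S :=
  measure_mono_null (fun _ ha => h ha) hT

theorem iUnion {ι : Type*} [Countable ι]
    {S : ι → Set (EuclideanSpace ℝ (Fin m) →ₗ[ℝ] EuclideanSpace ℝ (Fin l))}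
    (h : ∀ i, HasLebesgueMeasureZero (S i)) : HasLebesgueMeasureZero (⋃ i, S i) := by
  refine measure_mono_null (t := ⋃ i, {a | Matrix.toEuclideanLin (Matrix.of a) ∈ S i}) ?_
    (measure_iUnion_null h)
  intro a ha
  simpa using ha

theorem union {S T : Set (EuclideanSpace ℝ (Fin m) →ₗ[ℝ] EuclideanSpace ℝ (Fin l))}
    (hS : HasLebesgueMeasureZero S) (hT : HasLebesgueMeasureZero T) :
    HasLebesgueMeasureZero (S ∪ T) :=
  measure_union_null hS hT

/-- The linear equations `π (d x) = c x`, with `d x ≠ 0` and `x` ranging over a `C¹` family of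
fewer than `l` parameters, are solved only by a null set of linear maps `π`. -/
theorem of_parametrized_equation {E : Type*} [NormedAddCommGroup E] [NormedSpace ℝ E]
    [FiniteDimensional ℝ E] (hE : finrank ℝ E < l) {Ω : Set E}
    {d : E → EuclideanSpace ℝ (Fin m)} {c : E → EuclideanSpace ℝ (Fin l)}
    (hd : ∀ x ∈ Ω, ContDiffAt ℝ 1 d x) (hc : ∀ x ∈ Ω, ContDiffAt ℝ 1 c x) :
    HasLebesgueMeasureZero {π | ∃ x ∈ Ω, d x ≠ 0 ∧ π (d x) = c x} := by
  -- `Φ j (x, b)` is the matrix with entries `b` off the column `j` that sends `d x` to `c x`.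
  let Φ (j : Fin m) (y : E × (Fin l → {k : Fin m // k ≠ j} → ℝ)) : Fin l → Fin m → ℝ := fun i k =>
    if h : k ≠ j then y.2 i ⟨k, h⟩
    else (c y.1 i - ∑ k' : {k : Fin m // k ≠ j}, y.2 i k' * d y.1 k') / d y.1 j
  have hΦ (j : Fin m) : volume (Φ j '' {y | y.1 ∈ Ω ∧ d y.1 j ≠ 0}) = 0 := by
    refine addHaar_image_eq_zero_of_finrank_lt volume ?_ ?_
    · obtain ⟨m, rfl⟩ : ∃ m', m = m' + 1 := ⟨m - 1, by have := j.2; omega⟩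
      simp [Module.finrank_pi_fintype, Module.finrank_prod, mul_add]
      omega
    · rintro ⟨x, b⟩ ⟨hx, hj⟩
      have hd' (k : Fin m) : ContDiffAt ℝ 1
          (fun y : E × (Fin l → {k : Fin m // k ≠ j} → ℝ) => d y.1 k) (x, b) :=
        (contDiffAt_euclidean.1 (hd x hx) k).comp (x, b) contDiffAt_fst
      have hc' (i : Fin l) : ContDiffAt ℝ 1
          (fun y : E × (Fin l → {k : Fin m // k ≠ j} → ℝ) => c y.1 i) (x, b) :=
        (contDiffAt_euclidean.1 (hc x hx) i).comp (x, b) contDiffAt_fst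
      have hb (i : Fin l) (k : {k : Fin m // k ≠ j}) : ContDiffAt ℝ 1
          (fun y : E × (Fin l → {k : Fin m // k ≠ j} → ℝ) => y.2 i k) (x, b) := by
        fun_prop
      refine contDiffAt_pi.2 fun i => contDiffAt_pi.2 fun k => ?_
      by_cases h : k ≠ j
      · simpa [Φ, h] using hb i ⟨k, h⟩
      · simp only [Φ, h, dite_false]
        exact ((hc' i).sub (ContDiffAt.sum fun k' _ => (hb i k').mul (hd' k'))).fun_div (hd' j) hj
  refine measure_mono_null ?_ (measure_iUnion_null hΦ)
  rintro a ⟨x, hx, hdx, hax⟩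
  obtain ⟨j, hj⟩ : ∃ j, d x j ≠ 0 := by
    by_contra! h
    exact hdx (by ext j; simpa using h j)
  refine Set.mem_iUnion.2 ⟨j, (x, fun i k => a i k), ⟨hx, hj⟩, ?_⟩
  ext i k
  by_cases h : k ≠ j
  · simp [Φ, h]
  · obtain rfl : k = j := not_not.1 h
    have hi : ∑ k', a i k' * d x k' = c x i := by
      rw [← hax]
      simp [Matrix.toLpLin_apply, Matrix.mulVec, dotProduct]
    rw [Fintype.sum_eq_add_sum_subtype_ne _ k] at hi
    simp only [Φ, h, dite_false]
    rw [div_eq_iff hj, ← hi]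
    ring

end HasLebesgueMeasureZero

/-! ### Smooth maps on a manifold in charts -/

theorem exists_countable_cover_chart_source (n : ℕ) (N : Type*) [TopologicalSpace N]
    [ChartedSpace (EuclideanSpace ℝ (Fin n)) N] [SecondCountableTopology N] :
    ∃ s : Set N, s.Countable ∧
      ∀ q, ∃ r : s, q ∈ (chartAt (EuclideanSpace ℝ (Fin n)) (r : N)).source := by
  obtain ⟨s, hs, hcov⟩ := TopologicalSpace.countable_cover_nhds
    (fun q : N => chart_source_mem_nhds (EuclideanSpace ℝ (Fin n)) q)
  refine ⟨s, hs, fun q => ?_⟩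
  have hq : q ∈ ⋃ r ∈ s, (chartAt (EuclideanSpace ℝ (Fin n)) r).source := hcov ▸ Set.mem_univ q
  simpa using hq

section Manifold

variable {n : ℕ} {N : Type*} [TopologicalSpace N] [ChartedSpace (EuclideanSpace ℝ (Fin n)) N]
  [IsManifold (𝓡 n) ∞ N]

theorem ContMDiff.contDiffAt_comp_chart_symm {k : ℕ} {f : N → EuclideanSpace ℝ (Fin k)}
    (hf : ContMDiff (𝓡 n) (𝓡 k) ∞ f) (r : N) {x : EuclideanSpace ℝ (Fin n)}
    (hx : x ∈ (chartAt (EuclideanSpace ℝ (Fin n)) r).target) :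
    ContDiffAt ℝ ∞ (f ∘ (chartAt (EuclideanSpace ℝ (Fin n)) r).symm) x :=
  (hf.contMDiffAt.comp x (contMDiffAt_symm_of_mem_maximalAtlas
    (IsManifold.chart_mem_maximalAtlas r) hx)).contDiffAt

/-- The differential of `f` at `q`, computed in a chart that need not be the preferred one
at `q`. -/
theorem ContMDiff.mfderiv_eq_fderiv_comp_chart {k : ℕ} {f : N → EuclideanSpace ℝ (Fin k)}
    (hf : ContMDiff (𝓡 n) (𝓡 k) ∞ f) (r : N) {q : N}
    (hq : q ∈ (chartAt (EuclideanSpace ℝ (Fin n)) r).source)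
    (v : TangentSpace (𝓡 n) q) :
    mfderiv (𝓡 n) (𝓡 k) f q v =
      fderiv ℝ (f ∘ (chartAt (EuclideanSpace ℝ (Fin n)) r).symm)
        (chartAt (EuclideanSpace ℝ (Fin n)) r q)
        (mfderiv (𝓡 n) (𝓡 n) (chartAt (EuclideanSpace ℝ (Fin n)) r) q v) := by
  set e := chartAt (EuclideanSpace ℝ (Fin n)) r
  have h1 : MDifferentiableAt (𝓡 n) (𝓡 k) (f ∘ e.symm) (e q) :=
    ((hf.contDiffAt_comp_chart_symm r (e.map_source hq)).differentiableAt
      (by simp)).mdifferentiableAt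
  have h2 : MDifferentiableAt (𝓡 n) (𝓡 n) e q :=
    (contMDiffAt_of_mem_maximalAtlas (n := ∞)
      (IsManifold.chart_mem_maximalAtlas r) hq).mdifferentiableAt (by simp)
  have h3 : f =ᶠ[nhds q] (f ∘ e.symm) ∘ e := by
    filter_upwards [e.open_source.mem_nhds hq] with p hp
    simp [e.left_inv hp]
  rw [h3.mfderiv_eq, mfderiv_comp q h1 h2, mfderiv_eq_fderiv]
  rfl

/-! ### The two kinds of bad perturbation -/

variable [SecondCountableTopology N] {m l : ℕ}
  {f : N → EuclideanSpace ℝ (Fin m)} {g : N → EuclideanSpace ℝ (Fin l)}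

/-- The linear maps `π` for which `g + π ∘ f` identifies two points separated by `f`. -/
theorem hasLebesgueMeasureZero_identify_points (hl : 2 * n < l)
    (hf : ContMDiff (𝓡 n) (𝓡 m) ∞ f) (hg : ContMDiff (𝓡 n) (𝓡 l) ∞ g) :
    HasLebesgueMeasureZero {π | ∃ p q, f p - f q ≠ 0 ∧ π (f p - f q) = g q - g p} := by
  obtain ⟨s, hs, hcov⟩ := exists_countable_cover_chart_source n N
  have := hs.to_subtype
  let e (r : N) := chartAt (EuclideanSpace ℝ (Fin n)) r
  let V := EuclideanSpace ℝ (Fin n)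
  have key (r : s × s) := HasLebesgueMeasureZero.of_parametrized_equation (E := V × V)
    (by simpa [V, ← two_mul] using hl) (Ω := (e r.1).target ×ˢ (e r.2).target)
    (d := fun x => (f ∘ (e r.1).symm) x.1 - (f ∘ (e r.2).symm) x.2)
    (c := fun x => (g ∘ (e r.2).symm) x.2 - (g ∘ (e r.1).symm) x.1)
    (fun x hx => ((((hf.contDiffAt_comp_chart_symm r.1 hx.1).of_le (by simp)).comp x
      contDiffAt_fst).sub (((hf.contDiffAt_comp_chart_symm r.2 hx.2).of_le (by simp)).comp x
      contDiffAt_snd)))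
    (fun x hx => ((((hg.contDiffAt_comp_chart_symm r.2 hx.2).of_le (by simp)).comp x
      contDiffAt_snd).sub (((hg.contDiffAt_comp_chart_symm r.1 hx.1).of_le (by simp)).comp x
      contDiffAt_fst)))
  refine (HasLebesgueMeasureZero.iUnion key).mono ?_
  rintro π ⟨p, q, hd, h⟩
  obtain ⟨a, ha⟩ := hcov p
  obtain ⟨b, hb⟩ := hcov q
  refine Set.mem_iUnion.2 ⟨(a, b), (e a p, e b q),
    ⟨(e a).map_source ha, (e b).map_source hb⟩, ?_⟩
  simp only [Function.comp_apply, (e a).left_inv ha, (e b).left_inv hb]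
  exact ⟨hd, h⟩

/-- The linear maps `π` for which the differential of `g + π ∘ f` kills a tangent vector that is
not killed by the differential of `f`. -/
theorem hasLebesgueMeasureZero_kill_tangent (hl : 2 * n < l)
    (hf : ContMDiff (𝓡 n) (𝓡 m) ∞ f) (hg : ContMDiff (𝓡 n) (𝓡 l) ∞ g) :
    HasLebesgueMeasureZero {π : EuclideanSpace ℝ (Fin m) →ₗ[ℝ] EuclideanSpace ℝ (Fin l) |
      ∃ (q : N) (v : TangentSpace (𝓡 n) q), mfderiv (𝓡 n) (𝓡 m) f q v ≠ 0 ∧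
        π (mfderiv (𝓡 n) (𝓡 m) f q v) = -mfderiv (𝓡 n) (𝓡 l) g q v} := by
  obtain ⟨s, hs, hcov⟩ := exists_countable_cover_chart_source n N
  have := hs.to_subtype
  let e (r : N) := chartAt (EuclideanSpace ℝ (Fin n)) r
  let V := EuclideanSpace ℝ (Fin n)
  have smooth {k : ℕ} {h : N → EuclideanSpace ℝ (Fin k)} (hh : ContMDiff (𝓡 n) (𝓡 k) ∞ h)
      (r : N) (x : V × V) (hx : x.1 ∈ (e r).target) :
      ContDiffAt ℝ 1 (fun x : V × V => fderiv ℝ (h ∘ (e r).symm) x.1 x.2) x :=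
    (((hh.contDiffAt_comp_chart_symm r hx).fderiv_right (m := 1) (by norm_cast)).comp x
      contDiffAt_fst).clm_apply contDiffAt_snd
  have key (r : s) := HasLebesgueMeasureZero.of_parametrized_equation (E := V × V)
    (by simpa [V, ← two_mul] using hl) (Ω := {x | x.1 ∈ (e r).target})
    (d := fun x => fderiv ℝ (f ∘ (e r).symm) x.1 x.2)
    (c := fun x => -fderiv ℝ (g ∘ (e r).symm) x.1 x.2)
    (fun x hx => smooth hf r x hx) (fun x hx => (smooth hg r x hx).neg)
  refine (HasLebesgueMeasureZero.iUnion key).mono ?_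
  rintro π ⟨q, v, hd, h⟩
  obtain ⟨a, ha⟩ := hcov q
  rw [hf.mfderiv_eq_fderiv_comp_chart a ha] at hd h
  rw [hg.mfderiv_eq_fderiv_comp_chart a ha] at h
  exact Set.mem_iUnion.2 ⟨a, (e a q, mfderiv (𝓡 n) (𝓡 n) (e a) q v),
    (e a).map_source ha, hd, h⟩

end Manifold

theorem corollary5p5 (n m l : ℕ) (hn : 0 < n) (hm : 0 < m) (hl : 2 * n < l)
    (N : Type*) [TopologicalSpace N] [T2Space N] [SecondCountableTopology N]
    [ChartedSpace (EuclideanSpace ℝ (Fin n)) N] [IsManifold (𝓡 n) ∞ N]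
    (U : Set (EuclideanSpace ℝ (Fin m))) (hU : IsOpen U)
    (f : N → EuclideanSpace ℝ (Fin m)) (hfU : ∀ q, f q ∈ U)
    (hf : ContMDiff (𝓡 n) (𝓡 m) ∞ f) (hf_inj : Function.Injective f)
    (F : EuclideanSpace ℝ (Fin m) → EuclideanSpace ℝ (Fin l))
    (hF : ContDiffOn ℝ ∞ F U) :
    (∃ S : Set (EuclideanSpace ℝ (Fin m) →ₗ[ℝ] EuclideanSpace ℝ (Fin l)),
      HasLebesgueMeasureZero S ∧
        ∀ π, π ∉ S → Function.Injective (linearPerturbation F π ∘ f)) ∧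
    (IsSmoothImmersion n f →
      ∃ S : Set (EuclideanSpace ℝ (Fin m) →ₗ[ℝ] EuclideanSpace ℝ (Fin l)),
        HasLebesgueMeasureZero S ∧
          ∀ π, π ∉ S → Function.Injective (linearPerturbation F π ∘ f) ∧
            IsSmoothImmersion n (linearPerturbation F π ∘ f)) := by
  have hg : ContMDiff (𝓡 n) (𝓡 l) ∞ (F ∘ f) := fun q =>
    (hF.contDiffAt (hU.mem_nhds (hfU q))).contMDiffAt.comp q (hf q)
  have hinj (π : EuclideanSpace ℝ (Fin m) →ₗ[ℝ] EuclideanSpace ℝ (Fin l))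
      (hπ : π ∉ {π : EuclideanSpace ℝ (Fin m) →ₗ[ℝ] EuclideanSpace ℝ (Fin l) |
        ∃ p q, f p - f q ≠ 0 ∧ π (f p - f q) = (F ∘ f) q - (F ∘ f) p}) :
      Function.Injective (linearPerturbation F π ∘ f) := by
    intro p q hpq
    by_contra hne
    refine hπ ⟨p, q, sub_ne_zero.2 (hf_inj.ne hne), ?_⟩
    simp only [linearPerturbation, Function.comp_apply] at hpq ⊢
    rw [map_sub, sub_eq_sub_iff_add_eq_add, add_comm, hpq, add_comm]
  have hS := hasLebesgueMeasureZero_identify_points hl hf hg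
  refine ⟨⟨_, hS, hinj⟩, fun himm =>
    ⟨_, hS.union (hasLebesgueMeasureZero_kill_tangent hl hf hg), fun π hπ => ?_⟩⟩
  rw [Set.mem_union, not_or] at hπ
  have hπL : ContMDiff (𝓡 n) (𝓡 l) ∞ (LinearMap.toContinuousLinearMap π ∘ f) :=
    (LinearMap.toContinuousLinearMap π).contMDiff.comp hf
  refine ⟨hinj π hπ.1, hg.add hπL, fun q => ?_⟩
  refine (injective_iff_map_eq_zero _).2 fun v hv => ?_
  by_contra hv0
  refine hπ.2 ⟨q, v, fun h0 => hv0 (himm.2 q (h0.trans (map_zero _).symm)), ?_⟩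
  have hderiv : mfderiv (𝓡 n) (𝓡 l) (linearPerturbation F π ∘ f) q v =
      (show EuclideanSpace ℝ (Fin l) from mfderiv (𝓡 n) (𝓡 l) (F ∘ f) q v) +
        π (mfderiv (𝓡 n) (𝓡 m) f q v) := by
    have h1 : linearPerturbation F π ∘ f = F ∘ f + LinearMap.toContinuousLinearMap π ∘ f := rfl
    rw [h1, mfderiv_add (hg.mdifferentiable (by simp) q) (hπL.mdifferentiable (by simp) q),
      mfderiv_comp q (LinearMap.toContinuousLinearMap π).mdifferentiableAt
        (hf.mdifferentiable (by simp) q), ContinuousLinearMap.mfderiv_eq]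
    rfl
  exact eq_neg_of_add_eq_zero_right (hderiv.symm.trans hv)
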